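/- Let $(\mathcal X,\mathcal B)$ be a measurable space, $\pi$ a probability measure on it, and $\{P_\gamma\}_{\gamma\in\Gamma}$ a family of Markov kernels on $\mathcal X$ that are all $\pi$-invariant, $\pi$-irreducible and aperiodic. Suppose there are a measurable set $C$ with $\pi(C)>0$, a probability measure $\nu$ and a constant $\delta_0>0$ with $$P_\gamma(x,\cdot)\ \ge\ \delta_0\,\nu(\cdot)\qquad\text{for all }x\in C,\ \gamma\in\Gamma,$$ and that the simultaneous geometric drift condition holds: there are a measurable $V:\mathcal X\to[1,\infty)$ and constants $0<\lambda<1$, $b<\infty$ with $$P_\gamma V\ \le\ \lambda V+b\,\mathbf 1_C\qquad\text{for all }\gamma\in\Gamma .$$ For $\gamma\in\Gamma$ let $(X_n,Y_n)_{n\ge0}$ be the split chain on $\mathcal X\times\{0,1\}$ with $X_0\sim\nu$: given $X_n$ and the past, $Y_n=1$ with probability $\delta_0\mathbf 1_C(X_n)$; given $(X_n,Y_n)$ and the past, $X_{n+1}$ has law $\nu$ if $Y_n=1$, and law $$Q_\gamma(X_n,\cdot)=\frac{P_\gamma(X_n,\cdot)-\delta_0\nu(\cdot)\mathbf 1_C(X_n)}{1-\delta_0\mathbf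 1_C(X_n)}$$ if $Y_n=0$. Write $\mathbb E_{\nu,\gamma}$ for expectation under its law, and let $T=\inf\{n\ge1:Y_{n-1}=1\}$ be the regeneration time. Assume $\sup_{x\in C}V(x)<\infty$, and let $f:\mathcal X\to\mathbb R$ be measurable with $$\|f\|_{V^{1/2-\varepsilon}}:=\sup_{x\in\mathcal X}\frac{|f(x)|}{V(x)^{1/2-\varepsilon}}<\infty\qquad\text{for some }\varepsilon>0 .$$ Then for every $\gamma\in\Gamma$ the time $T$ is almost surely finite, and there is $\eta>0$ such that $$\sup_{\gamma\in\Gamma}\ \mathbb E_{\nu,\gamma}\left|\sum_{j=0}^{T-1}f(X_j)\right|^{2+\eta}<\infty .$$ -/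

import Mathlib

open MeasureTheory ProbabilityTheory
open scoped ENNReal NNReal

namespace AirMCMC

variable {Γ X : Type*} [MeasurableSpace X]

/-- A Markov kernel `K` is aperiodic (relative to its invariant probability measure `π`) if it has
no `d`-cycle with `d ≥ 2`: there are no pairwise disjoint measurable sets `D 0, …, D (d - 1)`
whose union has full measure and such that from `D i` the chain moves to `D (i + 1)`
(indices modulo `d`) with probability one. -/
def IsAperiodic (K : Kernel X X) (π : Measure X) : Prop :=
  ¬ ∃ (d : ℕ) (D : ZMod d → Set X), 2 ≤ d ∧ (∀ i, MeasurableSet (D i)) ∧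
    (∀ i j, i ≠ j → Disjoint (D i) (D j)) ∧
    (∀ i, ∀ x ∈ D i, K x (D (i + 1)) = 1) ∧ π (⋃ i, D i)ᶜ = 0

/-- The standing assumptions on the family of kernels: invariance, irreducibility, aperiodicity,
and the one step simultaneous minorisation `P γ x ≥ δ ν` for `x ∈ C` and all `γ`. -/
structure RegularSmallSet (P : Γ → Kernel X X) (π : Measure X) (C : Set X) (δ : ℝ≥0)
    (ν : Measure X) : Prop where
  invariant : ∀ γ, Kernel.Invariant (P γ) π
  irreducible : ∀ γ, Kernel.IsIrreducible π (P γ)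
  aperiodic : ∀ γ, IsAperiodic (P γ) π
  measurableSet : MeasurableSet C
  mass_pos : 0 < π C
  delta_pos : 0 < δ
  minorisation : ∀ γ, ∀ x ∈ C, δ • ν ≤ P γ x

/-- Simultaneous geometric drift `P γ V ≤ lam V + b 1_C` with `0 < lam < 1`, `V ≥ 1`. -/
structure GeometricDrift (P : Γ → Kernel X X) (C : Set X) (V : X → ℝ) (lam b : ℝ) : Prop where
  measurable : Measurable V
  one_le : ∀ x, 1 ≤ V x
  lam_pos : 0 < lam
  lam_lt_one : lam < 1
  drift : ∀ γ x, ∫⁻ y, ENNReal.ofReal (V y) ∂(P γ x) ≤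
    ENNReal.ofReal (lam * V x + C.indicator (fun _ => b) x)

/-- The weighted supremum norm `sup_x |g x| / W x` (for `W > 0`), with values in `[0, ∞]`. -/
noncomputable def wNorm (W g : X → ℝ) : ℝ≥0∞ := ⨆ x, ENNReal.ofReal (|g x| / W x)

section SplitChain

variable {C : Set X} {δ : ℝ≥0} {ν : Measure X}

theorem delta_le_one {K : Kernel X X} [IsMarkovKernel K] [IsProbabilityMeasure ν]
    (hmin : ∀ x ∈ C, δ • ν ≤ K x) {x : X} (hx : x ∈ C) : δ ≤ 1 := by
  have h := hmin x hx Set.univ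
  rw [Measure.smul_apply, measure_univ, measure_univ, ENNReal.smul_def, smul_eq_mul, mul_one] at h
  exact_mod_cast h

open Classical in
/-- The law of the coin `Y` given the state `x`: it is `true` with probability `δ 1_C(x)`. -/
noncomputable def coinMeasure (C : Set X) (δ : ℝ≥0) (x : X) : Measure Bool :=
  if x ∈ C then δ • Measure.dirac true + (1 - δ) • Measure.dirac false else Measure.dirac false

/-- The coin as a kernel. -/
noncomputable def coinKernel (hC : MeasurableSet C) (δ : ℝ≥0) : Kernel X Bool where
  toFun := coinMeasure C δ
  measurable' := by
    classical
    unfold coinMeasure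
    exact Measurable.ite hC measurable_const measurable_const

theorem isMarkovKernel_coinKernel (hC : MeasurableSet C) {K : Kernel X X} [IsMarkovKernel K]
    [IsProbabilityMeasure ν] (hmin : ∀ x ∈ C, δ • ν ≤ K x) :
    IsMarkovKernel (coinKernel hC δ) := by
  refine ⟨fun x => ⟨?_⟩⟩
  change coinMeasure C δ x Set.univ = 1
  unfold coinMeasure
  split_ifs with hx
  · have h := delta_le_one hmin hx
    simp only [Measure.add_apply, Measure.smul_apply, measure_univ, ENNReal.smul_def, smul_eq_mul,
      mul_one]
    exact_mod_cast add_tsub_cancel_of_le h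
  · simp

open Classical in
/-- The residual law `Q(x, ·) = (K(x, ·) - δ ν 1_C(x)) / (1 - δ 1_C(x))`. When `δ = 1` and `x ∈ C`
this is `0 / 0`; it is then never used by the split chain, and is set to `ν`. -/
noncomputable def residualMeasure (K : Kernel X X) (C : Set X) (δ : ℝ≥0) (ν : Measure X) (x : X) :
    Measure X :=
  if x ∈ C then (if δ < 1 then (1 - δ)⁻¹ • (K x - δ • ν) else ν) else K x

/-- The residual law as a kernel. -/
noncomputable def residualKernel (K : Kernel X X) [IsProbabilityMeasure ν]
    (hC : MeasurableSet C) (hmin : ∀ x ∈ C, δ • ν ≤ K x) : Kernel X X where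
  toFun := residualMeasure K C δ ν
  measurable' := by
    classical
    refine Measure.measurable_of_measurable_coe _ fun s hs => ?_
    have key : (fun x => residualMeasure K C δ ν x s) = fun x =>
        if x ∈ C then (if δ < 1 then (((1 - δ)⁻¹ : ℝ≥0) : ℝ≥0∞) * (K x s - δ * ν s) else ν s)
        else K x s := by
      funext x
      unfold residualMeasure
      split_ifs with hx hd
      · rw [Measure.smul_apply, Measure.sub_apply hs (hmin x hx), ENNReal.smul_def, smul_eq_mul,
          Measure.smul_apply, ENNReal.smul_def, smul_eq_mul]
      · rfl
      · rfl
    rw [key]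
    have hK : Measurable fun x => K x s := K.measurable_coe hs
    refine Measurable.ite hC ?_ hK
    split_ifs
    · exact (hK.sub_const _).const_mul _
    · exact measurable_const

theorem isMarkovKernel_residualKernel (K : Kernel X X) [IsMarkovKernel K] [IsProbabilityMeasure ν]
    (hC : MeasurableSet C) (hmin : ∀ x ∈ C, δ • ν ≤ K x) :
    IsMarkovKernel (residualKernel K hC hmin) := by
  refine ⟨fun x => ⟨?_⟩⟩
  change residualMeasure K C δ ν x Set.univ = 1
  unfold residualMeasure
  split_ifs with hx hd
  · rw [Measure.smul_apply, Measure.sub_apply MeasurableSet.univ (hmin x hx), Measure.smul_apply,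
      measure_univ, measure_univ, ENNReal.smul_def, smul_eq_mul, ENNReal.smul_def, smul_eq_mul,
      mul_one]
    have h0 : (1 - δ) ≠ 0 := (tsub_pos_of_lt hd).ne'
    have : ((1 - δ)⁻¹ * (1 - δ) : ℝ≥0) = 1 := inv_mul_cancel₀ h0
    exact_mod_cast this
  · exact measure_univ
  · exact measure_univ

/-- The law of `X_n` given `(X_{n-1}, Y_{n-1})`: it is `ν` if `Y_{n-1} = 1` and
`Q(X_{n-1}, ·)` if `Y_{n-1} = 0`. -/
noncomputable def moveKernel (K : Kernel X X) [IsProbabilityMeasure ν]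
    (hC : MeasurableSet C) (hmin : ∀ x ∈ C, δ • ν ≤ K x) : Kernel (X × Bool) X where
  toFun z := if z.2 = true then ν else residualKernel K hC hmin z.1
  measurable' :=
    Measurable.ite (measurable_snd (measurableSet_singleton true)) measurable_const
      ((residualKernel K hC hmin).measurable.comp measurable_fst)

theorem isMarkovKernel_moveKernel (K : Kernel X X) [IsMarkovKernel K] [IsProbabilityMeasure ν]
    (hC : MeasurableSet C) (hmin : ∀ x ∈ C, δ • ν ≤ K x) :
    IsMarkovKernel (moveKernel K hC hmin) := by
  have := isMarkovKernel_residualKernel K hC hmin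
  refine ⟨fun z => ?_⟩
  change IsProbabilityMeasure (if z.2 = true then ν else residualKernel K hC hmin z.1)
  split_ifs <;> infer_instance

/-- From a state `x`, the pair `(x, Y)` with `Y` the coin at `x`. -/
noncomputable def attachCoin (hC : MeasurableSet C) (δ : ℝ≥0) : Kernel X (X × Bool) :=
  Kernel.id ×ₖ coinKernel hC δ

/-- Transition kernel of the split chain: `X_n` is drawn given `(X_{n-1}, Y_{n-1})`, then `Y_n` is
the coin at `X_n`. -/
noncomputable def splitKernel (K : Kernel X X) [IsProbabilityMeasure ν]
    (hC : MeasurableSet C) (hmin : ∀ x ∈ C, δ • ν ≤ K x) : Kernel (X × Bool) (X × Bool) :=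
  attachCoin hC δ ∘ₖ moveKernel K hC hmin

theorem isMarkovKernel_splitKernel (K : Kernel X X) [IsMarkovKernel K] [IsProbabilityMeasure ν]
    (hC : MeasurableSet C) (hmin : ∀ x ∈ C, δ • ν ≤ K x) :
    IsMarkovKernel (splitKernel K hC hmin) := by
  have := isMarkovKernel_coinKernel hC hmin
  have := isMarkovKernel_moveKernel K hC hmin
  unfold splitKernel attachCoin
  infer_instance

/-- The law, on trajectories `ω = (X_n, Y_n)_{n ≥ 0}`, of the split chain of `K` started from
`X_0 ∼ ν`. -/
noncomputable def splitLaw (K : Kernel X X) [IsMarkovKernel K] [IsProbabilityMeasure ν]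
    (hC : MeasurableSet C) (hmin : ∀ x ∈ C, δ • ν ≤ K x) : Measure (ℕ → X × Bool) :=
  haveI := isMarkovKernel_coinKernel hC hmin
  haveI := isMarkovKernel_splitKernel K hC hmin
  haveI : IsProbabilityMeasure (ν.bind (attachCoin hC δ)) := by
    unfold attachCoin
    infer_instance
  Kernel.trajMeasure (X := fun _ => X × Bool) (ν.bind (attachCoin hC δ))
    (fun n => (splitKernel K hC hmin).comap
      (fun h : (Finset.Iic n → X × Bool) => h ⟨n, Finset.mem_Iic.2 le_rfl⟩)
      (measurable_pi_apply _))

end SplitChain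

/-- The regeneration time `T = inf {n ≥ 1 : Y_{n-1} = 1}`, with `inf ∅ = ∞`. -/
noncomputable def regenTime (ω : ℕ → X × Bool) : ℕ∞ :=
  ⨅ (n : ℕ) (_ : 1 ≤ n ∧ (ω (n - 1)).2 = true), (n : ℕ∞)

/-- The tour sum `∑_{j = 0}^{T - 1} f(X_j)` (meaningful when `T < ∞`). -/
noncomputable def tourSum (f : X → ℝ) (ω : ℕ → X × Bool) : ℝ :=
  ∑ j ∈ Finset.range (regenTime ω).toNat, f (ω j).1

/-- The uniform moment condition on tour sums: under every `γ` the regeneration time is almost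
surely finite (so that the tour sum is defined), and for some `η > 0`,
`sup_γ E_{ν,γ} |∑_{j<T} f(X_j)|^{2+η} < ∞`. -/
def TourMomentCondition (P : Γ → Kernel X X) [∀ γ, IsMarkovKernel (P γ)] {π : Measure X}
    {C : Set X} {δ : ℝ≥0} {ν : Measure X} [IsProbabilityMeasure ν]
    (h : RegularSmallSet P π C δ ν) (f : X → ℝ) : Prop :=
  (∀ γ, ∀ᵐ ω ∂(splitLaw (P γ) h.measurableSet (h.minorisation γ)), regenTime ω ≠ ⊤) ∧
  ∃ η : ℝ, 0 < η ∧
    ⨆ γ, ∫⁻ ω, ENNReal.ofReal (|tourSum f ω| ^ (2 + η))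
      ∂(splitLaw (P γ) h.measurableSet (h.minorisation γ)) < ∞

end AirMCMC

/-!
Up to the regeneration time the `X`-coordinate of the split chain is a chain killed at rate
`δ 1_C`: the law of `X_n` on `{n < T}` is `ν Q_γ ^ n`, where `Q_γ` is the sub-Markov kernel
`P_γ - δ 1_C ν`. Adding a constant `β` with `b ≤ δ β` to the drift function pays for the term
`b 1_C`, because the mass `δ ν` removed on `C` takes away at least `δ β`. Thus `W = V + β`
satisfies `Q_γ W ≤ a W` with `a = (lam + β) / (1 + β) < 1`, uniformly in `γ`, and
`E[W(X_n); n < T] ≤ a ^ n ν(W)`, where `ν(W)` is finite since `δ ν ≤ P_γ(x, ·)` for `x ∈ C`. As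
`W ≥ 1` this gives `T < ∞` almost surely. If `|f| ≤ c W ^ (1/p)`, then `f(X_n) 1_{n < T}` has `L^p`
norm at most `c (a ^ n ν(W)) ^ (1/p)`, which is summable in `n`, so Minkowski's inequality bounds
the `p`-th moment of the tour sum. The exponent `1/2 - ε` leaves room for `p = 2 + 4 ε > 2`.
-/

namespace AirMCMC

section KernelComposition

variable {X Y : Type*} [MeasurableSpace X] [MeasurableSpace Y] (μ : Measure X)

theorem restrict_comp (κ : Kernel X Y) {s : Set Y} (hs : MeasurableSet s) :
    (κ ∘ₘ μ).restrict s = κ.restrict hs ∘ₘ μ := by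
  rw [Measure.comp_eq_comp_const_apply, ← Kernel.restrict_apply _ hs, ← Kernel.comp_restrict,
    ← Measure.comp_eq_comp_const_apply]

theorem pow_zero_comp (κ : Kernel X X) : (κ ^ 0 : Kernel X X) ∘ₘ μ = μ :=
  Measure.id_comp

theorem pow_succ_comp (κ : Kernel X X) (n : ℕ) : (κ ^ (n + 1)) ∘ₘ μ = κ ∘ₘ ((κ ^ n) ∘ₘ μ) := by
  rw [pow_succ', Measure.comp_assoc]
  rfl

theorem lintegral_pow_comp_le {κ : Kernel X X} {W : X → ℝ≥0∞} (hW : Measurable W) {a : ℝ≥0∞}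
    (hκ : ∀ x, ∫⁻ y, W y ∂κ x ≤ a * W x) (n : ℕ) :
    ∫⁻ x, W x ∂((κ ^ n) ∘ₘ μ) ≤ a ^ n * ∫⁻ x, W x ∂μ := by
  induction n with
  | zero => rw [pow_zero_comp, pow_zero, one_mul]
  | succ n ih =>
    calc ∫⁻ x, W x ∂((κ ^ (n + 1)) ∘ₘ μ)
        = ∫⁻ x, ∫⁻ y, W y ∂κ x ∂((κ ^ n) ∘ₘ μ) := by
          rw [pow_succ_comp, Measure.lintegral_bind κ.aemeasurable hW.aemeasurable]
      _ ≤ a * ∫⁻ x, W x ∂((κ ^ n) ∘ₘ μ) :=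
          (lintegral_mono hκ).trans_eq (lintegral_const_mul a hW)
      _ ≤ a ^ (n + 1) * ∫⁻ x, W x ∂μ := by
          rw [pow_succ', mul_assoc]
          gcongr

end KernelComposition

section MarkovChain

variable {E : Type*} [MeasurableSpace E]

/-- The law of the trajectory of a time-homogeneous Markov chain with initial law `μ₀` and
transition kernel `κ`. The kernels on histories are written exactly as in `splitLaw`. -/
noncomputable def markovLaw (μ₀ : Measure E) (κ : Kernel E E) [IsMarkovKernel κ] :
    Measure (ℕ → E) :=
  Kernel.trajMeasure (X := fun _ => E) μ₀ fun n =>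
    κ.comap (fun h : (Finset.Iic n → E) => h ⟨n, Finset.mem_Iic.2 le_rfl⟩)
      (measurable_pi_apply _)

variable (μ₀ : Measure E) (κ : Kernel E E) [IsMarkovKernel κ]

instance [IsProbabilityMeasure μ₀] : IsProbabilityMeasure (markovLaw μ₀ κ) := by
  unfold markovLaw
  infer_instance

theorem map_eval_zero_markovLaw : (markovLaw μ₀ κ).map (fun ω => ω 0) = μ₀ := by
  let e : (Finset.Iic 0 → E) ≃ᵐ E := MeasurableEquiv.piUnique fun _ : Finset.Iic 0 => E
  have h : (markovLaw μ₀ κ).map (Preorder.frestrictLe 0) = μ₀.map e.symm := by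
    rw [markovLaw, Kernel.trajMeasure, Measure.map_comp _ _ (by fun_prop),
      Kernel.traj_map_frestrictLe, Kernel.partialTraj_self, Measure.id_comp]
  calc (markovLaw μ₀ κ).map (fun ω => ω 0)
      = (markovLaw μ₀ κ).map (e ∘ Preorder.frestrictLe 0) := rfl
    _ = ((markovLaw μ₀ κ).map (Preorder.frestrictLe 0)).map e :=
        (Measure.map_map e.measurable (Preorder.measurable_frestrictLe 0)).symm
    _ = μ₀ := by rw [h, MeasurableEquiv.map_map_symm]

theorem map_eval_succ_restrict_markovLaw [IsProbabilityMeasure μ₀] {n : ℕ}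
    {A : Set (Finset.Iic n → E)} (hA : MeasurableSet A) :
    ((markovLaw μ₀ κ).restrict (Preorder.frestrictLe n ⁻¹' A)).map (fun ω => ω (n + 1)) =
      κ ∘ₘ ((markovLaw μ₀ κ).restrict (Preorder.frestrictLe n ⁻¹' A)).map (fun ω => ω n) := by
  ext s hs
  have hjoint := congrArg (fun m => m (A ×ˢ s))
    (Kernel.map_frestrictLe_trajMeasure_compProd_eq_map_trajMeasure (X := fun _ => E) (μ₀ := μ₀)
      (κ := fun n => κ.comap (fun h : (Finset.Iic n → E) => h ⟨n, Finset.mem_Iic.2 le_rfl⟩)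
        (measurable_pi_apply _)) (a := n))
  beta_reduce at hjoint
  rw [Measure.compProd_apply_prod hA hs, Measure.map_apply (by fun_prop) (hA.prod hs),
    setLIntegral_map hA (Kernel.measurable_coe _ hs) (by fun_prop)] at hjoint
  rw [Measure.bind_apply hs κ.aemeasurable,
    lintegral_map (κ.measurable_coe hs) (measurable_pi_apply n),
    Measure.map_apply (measurable_pi_apply _) hs,
    Measure.restrict_apply (hs.preimage (measurable_pi_apply _)), Set.inter_comm]
  exact hjoint.symm

end MarkovChain

section RegenTime

variable {X : Type*}

theorem natCast_lt_regenTime_iff {ω : ℕ → X × Bool} {n : ℕ} :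
    (n : ℕ∞) < regenTime ω ↔ ∀ i < n, (ω i).2 = false := by
  rw [← ENat.add_one_le_iff (ENat.natCast_ne_top n), regenTime, le_iInf₂_iff]
  refine ⟨fun h i hi => ?_, fun h m hm => ?_⟩
  · by_contra hne
    have := h (i + 1) ⟨i.succ_pos, by simpa using hne⟩
    norm_cast at this
    omega
  · by_contra! hlt
    norm_cast at hlt
    simp [h (m - 1) (by omega)] at hm

theorem enorm_tourSum_le_tsum (f : X → ℝ) (ω : ℕ → X × Bool) :
    ‖tourSum f ω‖ₑ ≤
      ∑' n : ℕ, {ω | (n : ℕ∞) < regenTime ω}.indicator (fun ω => ‖f (ω n).1‖ₑ) ω := by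
  refine (enorm_sum_le _ _).trans (le_trans (Finset.sum_le_sum fun n hn => ?_)
    (ENNReal.sum_le_tsum (Finset.range (regenTime ω).toNat)))
  have hlt : (n : ℕ∞) < regenTime ω := by
    have hn := Finset.mem_range.1 hn
    have htop : regenTime ω ≠ ⊤ := fun h => by simp [h] at hn
    rw [← ENat.natCast_toNat htop]
    exact_mod_cast hn
  rw [Set.indicator_of_mem (by exact hlt)]

theorem setOf_succ_lt_regenTime_eq_preimage (n : ℕ) :
    {ω : ℕ → X × Bool | ((n + 1 : ℕ) : ℕ∞) < regenTime ω} =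
      Preorder.frestrictLe n ⁻¹' {h | ∀ i, (h i).2 = false} := by
  ext ω
  simp only [natCast_lt_regenTime_iff, Set.mem_ofPred_eq, Set.mem_preimage,
    Preorder.frestrictLe_apply, Subtype.forall, Finset.mem_Iic, Order.lt_add_one_iff]

theorem setOf_succ_lt_regenTime_eq_inter (n : ℕ) :
    {ω : ℕ → X × Bool | ((n + 1 : ℕ) : ℕ∞) < regenTime ω} =
      (fun ω => ω n) ⁻¹' (Prod.snd ⁻¹' {false}) ∩ {ω | (n : ℕ∞) < regenTime ω} := by
  ext ω
  simp only [natCast_lt_regenTime_iff, Set.mem_ofPred_eq, Set.mem_inter_iff, Set.mem_preimage,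
    Set.mem_singleton_iff, Nat.forall_lt_succ_right, and_comm]

theorem measurableSet_natCast_lt_regenTime [MeasurableSpace X] (n : ℕ) :
    MeasurableSet {ω : ℕ → X × Bool | (n : ℕ∞) < regenTime ω} := by
  simp only [natCast_lt_regenTime_iff]
  measurability

end RegenTime

section KilledKernel

variable {X : Type*} [MeasurableSpace X]

theorem measurableSet_tails : MeasurableSet (Prod.snd ⁻¹' {false} : Set (X × Bool)) :=
  measurable_snd (measurableSet_singleton false)

variable {C : Set X} {δ : ℝ≥0} {ν : Measure X} [IsProbabilityMeasure ν]
  (K : Kernel X X) (hC : MeasurableSet C) (hmin : ∀ x ∈ C, δ • ν ≤ K x)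

/-- The sub-Markov transition kernel of the `X`-coordinate of the split chain killed at
regeneration: draw the coin, discard the mass on which it comes up, then move. -/
noncomputable def killedKernel : Kernel X X :=
  moveKernel K hC hmin ∘ₖ (attachCoin hC δ).restrict measurableSet_tails

theorem killedKernel_apply [IsMarkovKernel K] (x : X) :
    killedKernel K hC hmin x = coinMeasure C δ x {false} • residualMeasure K C δ ν x := by
  have := isMarkovKernel_coinKernel hC hmin
  have hattach : (attachCoin hC δ).restrict measurableSet_tails x =
      coinMeasure C δ x {false} • Measure.dirac (x, false) := by
    rw [Kernel.restrict_apply, attachCoin, Kernel.prod_apply, Kernel.id_apply,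
      Measure.dirac_prod, Measure.restrict_map measurable_prodMk_left measurableSet_tails]
    change ((coinMeasure C δ x).restrict {false}).map _ = _
    rw [Measure.restrict_singleton, Measure.map_smul,
      Measure.map_dirac' measurable_prodMk_left]
  rw [killedKernel, Kernel.comp_apply, hattach, Measure.comp_smul,
    Measure.dirac_bind (Kernel.measurable _)]
  rfl

theorem killedKernel_apply_of_notMem [IsMarkovKernel K] {x : X} (hx : x ∉ C) :
    killedKernel K hC hmin x = K x := by
  simp [killedKernel_apply, coinMeasure, residualMeasure, hx]

theorem killedKernel_apply_add_of_mem [IsMarkovKernel K] {x : X} (hx : x ∈ C) :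
    killedKernel K hC hmin x + δ • ν = K x := by
  have hcoin : coinMeasure C δ x {false} = (1 - δ : ℝ≥0) := by
    simp [coinMeasure, hx]
  rw [killedKernel_apply, hcoin]
  rcases (delta_le_one hmin hx).lt_or_eq with hδ | rfl
  · rw [residualMeasure, if_pos hx, if_pos hδ, ← ENNReal.smul_def,
      smul_inv_smul₀ (tsub_pos_of_lt hδ).ne', Measure.sub_add_cancel_of_le (hmin x hx)]
  · simpa using Measure.eq_of_le_of_isProbabilityMeasure (by simpa using hmin x hx)

theorem lintegral_killedKernel_add_indicator_le [IsMarkovKernel K] {W : X → ℝ≥0∞} {β : ℝ≥0∞}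
    (hβ : ∀ x, β ≤ W x) (x : X) :
    ∫⁻ y, W y ∂killedKernel K hC hmin x + C.indicator (fun _ => δ * β) x ≤ ∫⁻ y, W y ∂K x := by
  by_cases hx : x ∈ C
  · calc ∫⁻ y, W y ∂killedKernel K hC hmin x + C.indicator (fun _ => δ * β) x
        = ∫⁻ y, W y ∂killedKernel K hC hmin x + δ • ∫⁻ _, β ∂ν := by
          rw [Set.indicator_of_mem hx, lintegral_const, measure_univ, mul_one, ENNReal.smul_def,
            smul_eq_mul]
      _ ≤ ∫⁻ y, W y ∂killedKernel K hC hmin x + δ • ∫⁻ y, W y ∂ν := by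
          gcongr with y
          exact hβ y
      _ = ∫⁻ y, W y ∂K x := by
          rw [← lintegral_smul_measure, ← lintegral_add_measure,
            killedKernel_apply_add_of_mem K hC hmin hx]
  · rw [Set.indicator_of_notMem hx, add_zero, killedKernel_apply_of_notMem K hC hmin hx]

end KilledKernel

theorem eLpNorm'_tsum_le {α ι : Type*} [MeasurableSpace α] [Countable ι] {μ : Measure α}
    {u : ι → α → ℝ≥0∞} (hu : ∀ i, AEMeasurable (u i) μ) {p : ℝ} (hp : 1 ≤ p) :
    eLpNorm' (fun x => ∑' i, u i x) p μ ≤ ∑' i, eLpNorm' (u i) p μ := by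
  have hp0 : 0 < p := zero_lt_one.trans_le hp
  have hsup : ∫⁻ x, (∑' i, u i x) ^ p ∂μ =
      ⨆ s : Finset ι, ∫⁻ x, (∑ i ∈ s, u i x) ^ p ∂μ := by
    rw [← lintegral_iSup_directed (fun s => by fun_prop)
      (Monotone.directed_le fun s t hst x => by dsimp only; gcongr)]
    refine lintegral_congr fun x => ?_
    rw [ENNReal.tsum_eq_iSup_sum]
    exact (ENNReal.orderIsoRpow p hp0).map_iSup _
  rw [eLpNorm', one_div, ENNReal.rpow_inv_le_iff hp0]
  simp only [enorm_eq_self]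
  rw [hsup]
  refine iSup_le fun s => ?_
  rw [← ENNReal.rpow_inv_le_iff hp0, ← one_div]
  calc (∫⁻ x, (∑ i ∈ s, u i x) ^ p ∂μ) ^ (1 / p)
      = eLpNorm' (∑ i ∈ s, u i) p μ := by simp [eLpNorm']
    _ ≤ ∑ i ∈ s, eLpNorm' (u i) p μ :=
        eLpNorm'_sum_le (fun i _ => (hu i).aestronglyMeasurable) hp
    _ ≤ ∑' i, eLpNorm' (u i) p μ := ENNReal.sum_le_tsum s

section Tour

variable {X : Type*} [MeasurableSpace X] {C : Set X} {δ : ℝ≥0} {ν : Measure X}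
  [IsProbabilityMeasure ν] (K : Kernel X X) [IsMarkovKernel K] (hC : MeasurableSet C)
  (hmin : ∀ x ∈ C, δ • ν ≤ K x)

theorem map_restrict_lt_regenTime (n : ℕ) :
    ((splitLaw K hC hmin).restrict {ω | (n : ℕ∞) < regenTime ω}).map (fun ω => ω n) =
      attachCoin hC δ ∘ₘ ((killedKernel K hC hmin ^ n) ∘ₘ ν) := by
  have := isMarkovKernel_coinKernel hC hmin
  have := isMarkovKernel_splitKernel K hC hmin
  have : IsProbabilityMeasure (ν.bind (attachCoin hC δ)) := by
    unfold attachCoin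
    infer_instance
  have hlaw : splitLaw K hC hmin =
      markovLaw (ν.bind (attachCoin hC δ)) (splitKernel K hC hmin) := rfl
  rw [hlaw]
  induction n with
  | zero =>
    have huniv : {ω : ℕ → X × Bool | ((0 : ℕ) : ℕ∞) < regenTime ω} = Set.univ :=
      Set.eq_univ_of_forall fun ω => natCast_lt_regenTime_iff.2 (by simp)
    rw [huniv, Measure.restrict_univ, map_eval_zero_markovLaw, pow_zero_comp]
  | succ n ih =>
    have hheads : MeasurableSet {h : Finset.Iic n → X × Bool | ∀ i, (h i).2 = false} := by
      measurability
    rw [setOf_succ_lt_regenTime_eq_preimage, map_eval_succ_restrict_markovLaw _ _ hheads,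
      ← setOf_succ_lt_regenTime_eq_preimage, setOf_succ_lt_regenTime_eq_inter,
      ← Measure.restrict_restrict (measurableSet_tails.preimage (measurable_pi_apply n)),
      ← Measure.restrict_map (measurable_pi_apply n) measurableSet_tails, ih,
      restrict_comp _ _ measurableSet_tails]
    simp only [splitKernel, pow_succ_comp, killedKernel, Measure.comp_assoc, Kernel.comp_assoc]

theorem setLIntegral_lt_regenTime {g : X → ℝ≥0∞} (hg : Measurable g) (n : ℕ) :
    ∫⁻ ω in {ω | (n : ℕ∞) < regenTime ω}, g (ω n).1 ∂splitLaw K hC hmin =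
      ∫⁻ x, g x ∂((killedKernel K hC hmin ^ n) ∘ₘ ν) := by
  have := isMarkovKernel_coinKernel hC hmin
  have hg' : Measurable fun z : X × Bool => g z.1 := hg.comp measurable_fst
  rw [← lintegral_map (f := fun z : X × Bool => g z.1) hg' (measurable_pi_apply n),
    map_restrict_lt_regenTime, Measure.lintegral_bind (Kernel.aemeasurable _) hg'.aemeasurable]
  refine lintegral_congr fun x => ?_
  rw [attachCoin, Kernel.lintegral_id_prod hg']
  change ∫⁻ _, g x ∂coinKernel hC δ x = g x
  rw [lintegral_const, measure_univ, mul_one]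

variable {K hC hmin} {W : X → ℝ≥0∞} {a : ℝ≥0∞}

theorem setLIntegral_lt_regenTime_le (hW : Measurable W)
    (hdrift : ∀ x, ∫⁻ y, W y ∂killedKernel K hC hmin x ≤ a * W x) (n : ℕ) :
    ∫⁻ ω in {ω | (n : ℕ∞) < regenTime ω}, W (ω n).1 ∂splitLaw K hC hmin ≤
      a ^ n * ∫⁻ x, W x ∂ν :=
  (setLIntegral_lt_regenTime K hC hmin hW n).trans_le (lintegral_pow_comp_le ν hW hdrift n)

theorem ae_regenTime_ne_top (hW : Measurable W) (hW1 : ∀ x, 1 ≤ W x)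
    (hdrift : ∀ x, ∫⁻ y, W y ∂killedKernel K hC hmin x ≤ a * W x) (ha : a < 1)
    (hν : ∫⁻ x, W x ∂ν ≠ ⊤) :
    ∀ᵐ ω ∂splitLaw K hC hmin, regenTime ω ≠ ⊤ := by
  have htail (n : ℕ) : splitLaw K hC hmin {ω | regenTime ω = ⊤} ≤ a ^ n * ∫⁻ x, W x ∂ν :=
    calc splitLaw K hC hmin {ω | regenTime ω = ⊤}
        ≤ splitLaw K hC hmin {ω | (n : ℕ∞) < regenTime ω} :=
          measure_mono fun ω (hω : regenTime ω = ⊤) => by simp [hω]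
      _ = ∫⁻ _ in {ω | (n : ℕ∞) < regenTime ω}, 1 ∂splitLaw K hC hmin := setLIntegral_one _ |>.symm
      _ ≤ ∫⁻ ω in {ω | (n : ℕ∞) < regenTime ω}, W (ω n).1 ∂splitLaw K hC hmin :=
          lintegral_mono fun ω => hW1 _
      _ ≤ a ^ n * ∫⁻ x, W x ∂ν := setLIntegral_lt_regenTime_le hW hdrift n
  have hlim : Filter.Tendsto (fun n : ℕ => a ^ n * ∫⁻ x, W x ∂ν) Filter.atTop (nhds 0) := by
    simpa using ENNReal.Tendsto.mul_const (ENNReal.tendsto_pow_atTop_nhds_zero_of_lt_one ha)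
      (.inr hν)
  simpa [ae_iff] using ge_of_tendsto' hlim htail

theorem eLpNorm'_indicator_lt_regenTime_le (hW : Measurable W)
    (hdrift : ∀ x, ∫⁻ y, W y ∂killedKernel K hC hmin x ≤ a * W x) (c : ℝ≥0∞) {p : ℝ} (hp : 0 < p)
    (n : ℕ) :
    eLpNorm' ({ω | (n : ℕ∞) < regenTime ω}.indicator fun ω => c * W (ω n).1 ^ p⁻¹) p
        (splitLaw K hC hmin) ≤
      c * (∫⁻ x, W x ∂ν) ^ p⁻¹ * (a ^ p⁻¹) ^ n := by
  have hpow : ∀ ω : ℕ → X × Bool,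
      ‖{ω | (n : ℕ∞) < regenTime ω}.indicator (fun ω => c * W (ω n).1 ^ p⁻¹) ω‖ₑ ^ p =
        {ω | (n : ℕ∞) < regenTime ω}.indicator (fun ω => c ^ p * W (ω n).1) ω := by
    intro ω
    by_cases hω : (n : ℕ∞) < regenTime ω <;>
      simp [Set.indicator, hω, ENNReal.mul_rpow_of_nonneg, hp, hp.le, hp.ne']
  rw [eLpNorm', one_div, ENNReal.rpow_inv_le_iff hp, lintegral_congr hpow,
    lintegral_indicator (measurableSet_natCast_lt_regenTime n), lintegral_const_mul _ (by fun_prop)]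
  calc c ^ p * ∫⁻ ω in {ω | (n : ℕ∞) < regenTime ω}, W (ω n).1 ∂splitLaw K hC hmin
      ≤ c ^ p * (a ^ n * ∫⁻ x, W x ∂ν) := by
        gcongr
        exact setLIntegral_lt_regenTime_le hW hdrift n
    _ = (c * (∫⁻ x, W x ∂ν) ^ p⁻¹ * (a ^ p⁻¹) ^ n) ^ p := by
        simp only [ENNReal.mul_rpow_of_nonneg _ _ hp.le, ENNReal.rpow_inv_rpow hp.ne',
          ← ENNReal.rpow_natCast, ← ENNReal.rpow_mul]
        field_simp
        ring

theorem eLpNorm'_tourSum_le (hW : Measurable W)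
    (hdrift : ∀ x, ∫⁻ y, W y ∂killedKernel K hC hmin x ≤ a * W x) {f : X → ℝ} {c : ℝ≥0∞} {p : ℝ}
    (hp : 1 ≤ p) (hf : ∀ x, ‖f x‖ₑ ≤ c * W x ^ p⁻¹) :
    eLpNorm' (tourSum f) p (splitLaw K hC hmin) ≤
      c * (∫⁻ x, W x ∂ν) ^ p⁻¹ * (1 - a ^ p⁻¹)⁻¹ := by
  let u (n : ℕ) : (ℕ → X × Bool) → ℝ≥0∞ :=
    {ω | (n : ℕ∞) < regenTime ω}.indicator fun ω => c * W (ω n).1 ^ p⁻¹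
  have hu (n : ℕ) : AEMeasurable (u n) (splitLaw K hC hmin) :=
    (Measurable.indicator (by fun_prop) (measurableSet_natCast_lt_regenTime n)).aemeasurable
  have hle (ω : ℕ → X × Bool) : ‖tourSum f ω‖ₑ ≤ ‖∑' n, u n ω‖ₑ :=
    (enorm_tourSum_le_tsum f ω).trans
      (ENNReal.tsum_le_tsum fun n => Set.indicator_le_indicator (hf _))
  calc eLpNorm' (tourSum f) p (splitLaw K hC hmin)
      ≤ eLpNorm' (fun ω => ∑' n, u n ω) p (splitLaw K hC hmin) :=
        eLpNorm'_mono_enorm_ae (zero_le_one.trans hp) (.of_forall hle)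
    _ ≤ ∑' n, eLpNorm' (u n) p (splitLaw K hC hmin) := eLpNorm'_tsum_le hu hp
    _ ≤ ∑' n, c * (∫⁻ x, W x ∂ν) ^ p⁻¹ * (a ^ p⁻¹) ^ n :=
        ENNReal.tsum_le_tsum
          (eLpNorm'_indicator_lt_regenTime_le hW hdrift c (zero_lt_one.trans_le hp))
    _ = c * (∫⁻ x, W x ∂ν) ^ p⁻¹ * (1 - a ^ p⁻¹)⁻¹ := by
        rw [ENNReal.tsum_mul_left, ENNReal.tsum_geometric]

end Tour

section Drift

theorem lintegral_ne_top_of_smul_le {X : Type*} [MeasurableSpace X] {μ ν : Measure X} {δ : ℝ≥0}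
    (hδ : δ ≠ 0) (hle : δ • ν ≤ μ) {W : X → ℝ≥0∞} (hμ : ∫⁻ x, W x ∂μ ≠ ⊤) :
    ∫⁻ x, W x ∂ν ≠ ⊤ := by
  intro htop
  have hsmul : ∫⁻ x, W x ∂(δ • ν) ≠ ⊤ := ne_top_of_le_ne_top hμ (lintegral_mono' hle le_rfl)
  rw [lintegral_smul_measure, htop, ENNReal.smul_top] at hsmul
  simp [hδ] at hsmul

theorem add_le_driftRate_mul {lam β v : ℝ} (hlam : lam ≤ 1) (hβ : 0 ≤ β) (hv : 1 ≤ v) :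
    lam * v + β ≤ (lam + β) / (1 + β) * (v + β) := by
  rw [div_mul_eq_mul_div, le_div_iff₀ (by linarith)]
  nlinarith [mul_nonneg hβ (mul_nonneg (sub_nonneg.2 hv) (sub_nonneg.2 hlam))]

variable {Γ X : Type*} [MeasurableSpace X] {P : Γ → Kernel X X} [∀ γ, IsMarkovKernel (P γ)]
  {C : Set X} {V : X → ℝ} {lam b : ℝ}

theorem GeometricDrift.nonempty [Nonempty Γ] [Nonempty X] (h : GeometricDrift P C V lam b) :
    C.Nonempty := by
  by_contra! hempty
  obtain ⟨γ⟩ := ‹Nonempty Γ›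
  obtain ⟨x₀⟩ := ‹Nonempty X›
  set m : ℝ≥0∞ := ⨅ x, ENNReal.ofReal (V x) with hm
  have hm1 : 1 ≤ m := le_iInf fun x => ENNReal.one_le_ofReal.2 (h.one_le x)
  have hmtop : m ≠ ⊤ := ne_top_of_le_ne_top ENNReal.ofReal_ne_top (iInf_le _ x₀)
  have hcontract : m ≤ ENNReal.ofReal lam * m := by
    rw [hm, ENNReal.mul_iInf_of_ne (ENNReal.ofReal_pos.2 h.lam_pos).ne' ENNReal.ofReal_ne_top]
    refine le_iInf fun x => ?_
    calc ⨅ y, ENNReal.ofReal (V y)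
        ≤ ∫⁻ y, ENNReal.ofReal (V y) ∂P γ x := iInf_le_lintegral _
      _ ≤ ENNReal.ofReal lam * ENNReal.ofReal (V x) := by
          simpa [hempty, ENNReal.ofReal_mul h.lam_pos.le] using h.drift γ x
  have hlt : ENNReal.ofReal lam * m < 1 * m :=
    ENNReal.mul_lt_mul_left (zero_lt_one.trans_le hm1).ne' hmtop
      (ENNReal.ofReal_lt_one.2 h.lam_lt_one)
  exact (hcontract.trans_lt hlt).ne (one_mul m).symm

variable {δ : ℝ≥0}

theorem GeometricDrift.lintegral_add_le (h : GeometricDrift P C V lam b) {β : ℝ} (hβ : 0 ≤ β)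
    (hb : b ≤ δ * β) (γ : Γ) (x : X) :
    ∫⁻ y, ENNReal.ofReal (V y + β) ∂P γ x ≤
      ENNReal.ofReal (lam * V x + β) + C.indicator (fun _ => δ * ENNReal.ofReal β) x := by
  have hV (y : X) : 0 ≤ V y := zero_le_one.trans (h.one_le y)
  have hlamV : 0 ≤ lam * V x := mul_nonneg h.lam_pos.le (hV x)
  have hdrift : ∫⁻ y, ENNReal.ofReal (V y) ∂P γ x ≤
      ENNReal.ofReal (lam * V x) + C.indicator (fun _ => δ * ENNReal.ofReal β) x := by
    refine (h.drift γ x).trans ?_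
    by_cases hx : x ∈ C
    · rw [Set.indicator_of_mem hx, Set.indicator_of_mem hx, ← ENNReal.ofReal_coe_nnreal,
        ← ENNReal.ofReal_mul δ.coe_nonneg, ← ENNReal.ofReal_add hlamV (by positivity)]
      gcongr
    · simp [hx]
  calc ∫⁻ y, ENNReal.ofReal (V y + β) ∂P γ x
      = ∫⁻ y, ENNReal.ofReal (V y) ∂P γ x + ENNReal.ofReal β := by
        simp_rw [fun y => ENNReal.ofReal_add (hV y) hβ]
        rw [lintegral_add_right _ measurable_const, lintegral_const, measure_univ, mul_one]
    _ ≤ ENNReal.ofReal (lam * V x) + C.indicator (fun _ => δ * ENNReal.ofReal β) x +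
          ENNReal.ofReal β := by gcongr
    _ = ENNReal.ofReal (lam * V x + β) + C.indicator (fun _ => δ * ENNReal.ofReal β) x := by
        rw [ENNReal.ofReal_add hlamV hβ, add_right_comm]

variable {ν : Measure X} [IsProbabilityMeasure ν] (hC : MeasurableSet C)
  (hmin : ∀ γ, ∀ x ∈ C, δ • ν ≤ P γ x)

theorem GeometricDrift.lintegral_killedKernel_le (h : GeometricDrift P C V lam b) {β : ℝ}
    (hβ : 0 ≤ β) (hb : b ≤ δ * β) (γ : Γ) (x : X) :
    ∫⁻ y, ENNReal.ofReal (V y + β) ∂killedKernel (P γ) hC (hmin γ) x ≤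
      ENNReal.ofReal ((lam + β) / (1 + β)) * ENNReal.ofReal (V x + β) := by
  have hlam := h.lam_pos
  have hβle (y : X) : ENNReal.ofReal β ≤ ENNReal.ofReal (V y + β) :=
    ENNReal.ofReal_le_ofReal (le_add_of_nonneg_left (zero_le_one.trans (h.one_le y)))
  have hfin : C.indicator (fun _ => δ * ENNReal.ofReal β) x ≠ ⊤ :=
    ne_top_of_le_ne_top (ENNReal.mul_ne_top ENNReal.coe_ne_top ENNReal.ofReal_ne_top)
      (Set.indicator_le_self C _ x)
  calc ∫⁻ y, ENNReal.ofReal (V y + β) ∂killedKernel (P γ) hC (hmin γ) x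
      ≤ ENNReal.ofReal (lam * V x + β) :=
        ENNReal.le_of_add_le_add_right hfin
          ((lintegral_killedKernel_add_indicator_le (P γ) hC (hmin γ) hβle x).trans
            (h.lintegral_add_le hβ hb γ x))
    _ ≤ ENNReal.ofReal ((lam + β) / (1 + β) * (V x + β)) :=
        ENNReal.ofReal_le_ofReal (add_le_driftRate_mul h.lam_lt_one.le hβ (h.one_le x))
    _ = ENNReal.ofReal ((lam + β) / (1 + β)) * ENNReal.ofReal (V x + β) :=
        ENNReal.ofReal_mul (by positivity)

theorem GeometricDrift.exists_killedKernel_drift [Nonempty Γ] (h : GeometricDrift P C V lam b)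
    (hδ : 0 < δ) :
    ∃ (W : X → ℝ≥0∞) (a : ℝ≥0∞), Measurable W ∧ a < 1 ∧ (∀ x, ENNReal.ofReal (V x) ≤ W x) ∧
      (∀ γ x, ∫⁻ y, W y ∂killedKernel (P γ) hC (hmin γ) x ≤ a * W x) ∧ ∫⁻ x, W x ∂ν ≠ ⊤ := by
  set β : ℝ := |b| / δ
  have hβ : 0 ≤ β := by positivity
  have hb : b ≤ δ * β := by
    rw [mul_div_cancel₀ _ (NNReal.coe_pos.2 hδ).ne']
    exact le_abs_self b
  refine ⟨fun x => ENNReal.ofReal (V x + β), ENNReal.ofReal ((lam + β) / (1 + β)),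
    (h.measurable.add_const β).ennreal_ofReal, ?_, ?_,
    h.lintegral_killedKernel_le hC hmin hβ hb, ?_⟩
  · rw [ENNReal.ofReal_lt_one, div_lt_one (by positivity)]
    linarith [h.lam_lt_one]
  · exact fun x => ENNReal.ofReal_le_ofReal (le_add_of_nonneg_right hβ)
  · have := nonempty_of_isProbabilityMeasure ν
    obtain ⟨γ⟩ := ‹Nonempty Γ›
    obtain ⟨x, hx⟩ := h.nonempty
    have hPx : ∫⁻ y, ENNReal.ofReal (V y + β) ∂P γ x ≠ ⊤ :=
      ne_top_of_le_ne_top (by simp [hx, ENNReal.mul_eq_top]) (h.lintegral_add_le hβ hb γ x)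
    exact lintegral_ne_top_of_smul_le hδ.ne' (hmin γ x hx) hPx

end Drift

section WeightedNorm

variable {X : Type*} {W g : X → ℝ}

theorem enorm_le_wNorm_mul {x : X} (hx : 0 < W x) : ‖g x‖ₑ ≤ wNorm W g * ENNReal.ofReal (W x) :=
  calc ‖g x‖ₑ = ENNReal.ofReal (|g x| / W x) * ENNReal.ofReal (W x) := by
        rw [← ENNReal.ofReal_mul (by positivity), div_mul_cancel₀ _ hx.ne',
          Real.enorm_eq_ofReal_abs]
    _ ≤ wNorm W g * ENNReal.ofReal (W x) := by
        gcongr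
        exact le_iSup (fun x => ENNReal.ofReal (|g x| / W x)) x

theorem enorm_le_wNorm_rpow_mul {x : X} {w : ℝ≥0∞} (hx : 0 < W x) (hw : ENNReal.ofReal (W x) ≤ w)
    {s : ℝ} (hs : 0 ≤ s) : ‖g x‖ₑ ≤ wNorm (fun x => W x ^ s) g * w ^ s :=
  calc ‖g x‖ₑ ≤ wNorm (fun x => W x ^ s) g * ENNReal.ofReal (W x ^ s) :=
        enorm_le_wNorm_mul (W := fun x => W x ^ s) (Real.rpow_pos_of_pos hx s)
    _ ≤ wNorm (fun x => W x ^ s) g * w ^ s := by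
        rw [← ENNReal.ofReal_rpow_of_pos hx]
        gcongr

theorem wNorm_rpow_anti (hW : ∀ x, 1 ≤ W x) {s t : ℝ} (hst : s ≤ t) :
    wNorm (fun x => W x ^ t) g ≤ wNorm (fun x => W x ^ s) g :=
  iSup_mono fun x => ENNReal.ofReal_le_ofReal (div_le_div_of_nonneg_left (abs_nonneg _)
    (Real.rpow_pos_of_pos (zero_lt_one.trans_le (hW x)) s)
    (Real.rpow_le_rpow_of_exponent_le (hW x) hst))

theorem half_sub_le_inv_two_add {ε : ℝ} (hε : 0 ≤ ε) : 1 / 2 - ε ≤ (2 + 4 * ε)⁻¹ := by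
  rw [← one_div, le_div_iff₀ (by positivity)]
  nlinarith [sq_nonneg ε]

end WeightedNorm

theorem lintegral_ofReal_abs_rpow {α : Type*} [MeasurableSpace α] {μ : Measure α} (g : α → ℝ)
    {p : ℝ} (hp : 0 < p) :
    ∫⁻ x, ENNReal.ofReal (|g x| ^ p) ∂μ = eLpNorm' g p μ ^ p := by
  rw [← lintegral_rpow_enorm_eq_rpow_eLpNorm' hp]
  refine lintegral_congr fun x => ?_
  rw [Real.enorm_eq_ofReal_abs, ENNReal.ofReal_rpow_of_nonneg (abs_nonneg _) hp.le]

end AirMCMC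

theorem mainTheorem7_general {Γ X : Type*} [MeasurableSpace X] (P : Γ → Kernel X X)
    [∀ γ, IsMarkovKernel (P γ)] (C : Set X) (hC : MeasurableSet C) (δ : ℝ≥0) (hδ : 0 < δ)
    (ν : Measure X) [IsProbabilityMeasure ν] (hmin : ∀ γ, ∀ x ∈ C, δ • ν ≤ P γ x)
    (V : X → ℝ) (lam b : ℝ) (hdrift : AirMCMC.GeometricDrift P C V lam b)
    (p : ℝ) (hp : 1 ≤ p) (f : X → ℝ) (hfV : AirMCMC.wNorm (fun x => V x ^ p⁻¹) f < ∞) :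
    (∀ γ, ∀ᵐ ω ∂AirMCMC.splitLaw (P γ) hC (hmin γ), AirMCMC.regenTime ω ≠ ⊤) ∧
      ⨆ γ, ∫⁻ ω, ENNReal.ofReal (|AirMCMC.tourSum f ω| ^ p)
        ∂AirMCMC.splitLaw (P γ) hC (hmin γ) < ∞ := by
  rcases isEmpty_or_nonempty Γ with hΓ | hΓ
  · exact ⟨isEmptyElim, by simp⟩
  have hp0 : 0 < p := zero_lt_one.trans_le hp
  obtain ⟨W, a, hW, ha, hVW, hkilled, hν⟩ := hdrift.exists_killedKernel_drift hC hmin hδ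
  have hW1 (x : X) : 1 ≤ W x := (ENNReal.one_le_ofReal.2 (hdrift.one_le x)).trans (hVW x)
  set c := AirMCMC.wNorm (fun x => V x ^ p⁻¹) f
  have hf (x : X) : ‖f x‖ₑ ≤ c * W x ^ p⁻¹ :=
    AirMCMC.enorm_le_wNorm_rpow_mul (zero_lt_one.trans_le (hdrift.one_le x)) (hVW x)
      (inv_nonneg.2 hp0.le)
  have hbound : c * (∫⁻ x, W x ∂ν) ^ p⁻¹ * (1 - a ^ p⁻¹)⁻¹ ≠ ⊤ :=
    ENNReal.mul_ne_top
      (ENNReal.mul_ne_top hfV.ne (ENNReal.rpow_ne_top_of_nonneg (inv_nonneg.2 hp0.le) hν))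
      (ENNReal.inv_ne_top.2 (tsub_pos_of_lt (ENNReal.rpow_lt_one ha (inv_pos.2 hp0))).ne')
  refine ⟨fun γ => AirMCMC.ae_regenTime_ne_top hW hW1 (hkilled γ) ha hν,
    (iSup_le fun γ => ?_).trans_lt (ENNReal.rpow_lt_top_of_nonneg hp0.le hbound)⟩
  rw [AirMCMC.lintegral_ofReal_abs_rpow _ hp0]
  gcongr
  exact AirMCMC.eLpNorm'_tourSum_le hW (hkilled γ) hp hf

theorem mainTheorem7 {Γ X : Type*} [MeasurableSpace X]
    (P : Γ → ProbabilityTheory.Kernel X X) [∀ γ, ProbabilityTheory.IsMarkovKernel (P γ)]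
    (π : MeasureTheory.Measure X) [MeasureTheory.IsProbabilityMeasure π]
    (C : Set X) (δ : ℝ≥0)
    (ν : MeasureTheory.Measure X) [MeasureTheory.IsProbabilityMeasure ν]
    (hreg : AirMCMC.RegularSmallSet P π C δ ν)
    (V : X → ℝ) (lam b : ℝ) (hdrift : AirMCMC.GeometricDrift P C V lam b)
    (hVC : BddAbove (V '' C))
    (f : X → ℝ) (hf : Measurable f)
    (ε : ℝ) (hε : 0 < ε)
    (hfV : AirMCMC.wNorm (fun x => V x ^ (1 / 2 - ε)) f < ∞) :
    AirMCMC.TourMomentCondition P hreg f :=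
  have ⟨hfinite, hmoment⟩ := mainTheorem7_general P C hreg.measurableSet δ hreg.delta_pos ν
    hreg.minorisation V lam b hdrift (2 + 4 * ε) (by linarith) f
    ((AirMCMC.wNorm_rpow_anti hdrift.one_le (AirMCMC.half_sub_le_inv_two_add hε.le)).trans_lt hfV)
  ⟨hfinite, 4 * ε, by positivity, hmoment⟩
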